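/- Let $N,L\ge 1$, let $M\in\mathbb{R}^{N\times N}$ and $u\in\mathbb{R}^N$ have positive entries, and let $\|\cdot\|$ be an order-preserving polyhedral norm on $\mathbb{R}^N$, i.e. a norm such that $\|x\|=\max_{1\le l\le L}a_l^{\mathsf T}|x|$ for all $x\in\mathbb{R}^N$, where $a_1,\dots,a_L\in\mathbb{R}_+^N\setminus\{0\}$ and $|x|=(|x_n|)_n$. Put $G(x)=Mx+\|x\|\,u$ for $x\in\mathbb{R}_+^N$ and $M_l=M+u a_l^{\mathsf T}$ for $l=1,\dots,L$. For a mapping $T:\mathbb{R}_+^N\to\mathbb{R}_+^N$ (in particular for a nonnegative matrix, regarded as a linear mapping) let $\rho(T)=\sup\{\lambda\ge 0\mid \exists x\in\mathbb{R}_+^N\setminus\{0\}:\ T(x)=\lambda x\}$, and for $x\in\mathbb{R}_+^N$ let $\varrho_G(x)=\rho\big(p\mapsto\mathrm{diag}(x)G(p)\big)$ and $\varrho_{M_l}(x)=\rho\big(p\mapsto\mathrm{diag}(x)M_lp\big)=\rho(\mathrm{diag}(x)M_l)$. Let $C_G=\{x\in\mathbb{R}_+^N\mid\varrho_G(x)\le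 1\}$, $S=\mathrm{conv}(C_G\cup -C_G)$ and $\|x\|_G=\inf\{\gamma>0\mid \gamma^{-1}x\in S\}$ for $x\in\mathbb{R}^N$. Assume that $\varrho_{M_l}$ is convex on $\mathbb{R}_{++}^N=(0,\infty)^N$ for every $l$. Let $s\in\mathbb{R}_{++}^N$ and $l^\star\in\operatorname{argmax}_{1\le l\le L}\varrho_{M_l}(s)=\operatorname{argmax}_{1\le l\le L}\rho(\mathrm{diag}(s)M_l)$. Then $\|\cdot\|_G$ is a convex function on $\mathbb{R}^N$, $\rho(\mathrm{diag}(s)M_{l^\star})>0$, there exist vectors $\xi,\eta\in\mathbb{R}_{++}^N$ with $$\mathrm{diag}(s)M_{l^\star}\xi=\rho(\mathrm{diag}(s)M_{l^\star})\,\xi,\qquad \eta^{\mathsf T}\mathrm{diag}(s)M_{l^\star}=\rho(\mathrm{diag}(s)M_{l^\star})\,\eta^{\mathsf T},$$ and for all such $\xi,\eta$ $$\frac{\mathrm{diag}(\eta)M_{l^\star}\xi}{\eta^{\mathsf T}\xi}\in\partial\|\cdot\|_G(s),$$ where $\partial h(x)=\{v\in\mathbb{R}^N\mid \forall y\in\mathbb{R}^N:\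 (y-x)^{\mathsf T}v+h(x)\le h(y)\}$. -/

import Mathlib

open scoped Matrix

namespace MaxLin

noncomputable section

/-- An order-preserving norm on `ℝ^N`: a norm that is monotone on the nonnegative orthant. -/
structure IsOrderPreservingNorm {N : ℕ} (nrm : (Fin N → ℝ) → ℝ) : Prop where
  add_le : ∀ x y, nrm (x + y) ≤ nrm x + nrm y
  smul : ∀ (c : ℝ) (x), nrm (c • x) = |c| * nrm x
  eq_zero : ∀ x, nrm x = 0 → x = 0
  mono : ∀ x y, 0 ≤ x → x ≤ y → nrm x ≤ nrm y

/-- `nrm` is a polyhedral order-preserving norm, represented by the nonzero nonnegative vectors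
`a l`: `nrm x = max_l (a l)ᵀ |x|`, where `|x|` is the coordinatewise absolute value. -/
structure IsPolyhedralNorm {N L : ℕ} (nrm : (Fin N → ℝ) → ℝ) (a : Fin L → Fin N → ℝ) : Prop
    extends IsOrderPreservingNorm nrm where
  nonneg : ∀ l, 0 ≤ a l
  ne_zero : ∀ l, a l ≠ 0
  eq_max : ∀ x, IsGreatest (Set.range fun l => a l ⬝ᵥ |x|) (nrm x)

/-- The spectral radius of a mapping `T` of the nonnegative orthant of `ℝ^N` into itself: the
supremum of its nonnegative eigenvalues with nonzero nonnegative eigenvectors. Only the values of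
`T` on the nonnegative orthant are used. -/
def specRadius {N : ℕ} (T : (Fin N → ℝ) → (Fin N → ℝ)) : ℝ :=
  sSup {c : ℝ | 0 ≤ c ∧ ∃ x : Fin N → ℝ, 0 ≤ x ∧ x ≠ 0 ∧ T x = c • x}

/-- The spectral radius of a nonnegative matrix, regarded as a linear mapping of the nonnegative
orthant. -/
def matSpecRadius {N : ℕ} (A : Matrix (Fin N) (Fin N) ℝ) : ℝ :=
  specRadius fun p => A *ᵥ p

/-- The nonlinear spectral radius function of `G`: it sends `x` to the spectral radius of the
mapping `p ↦ diag(x) G(p)`. -/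
def varrho {N : ℕ} (G : (Fin N → ℝ) → (Fin N → ℝ)) (x : Fin N → ℝ) : ℝ :=
  specRadius fun p => Matrix.diagonal x *ᵥ G p

/-- The nonlinear spectral radius function of the linear mapping given by `M`. -/
def matVarrho {N : ℕ} (M : Matrix (Fin N) (Fin N) ℝ) (x : Fin N → ℝ) : ℝ :=
  varrho (fun p => M *ᵥ p) x

/-- The max-linear mapping `x ↦ M x + ‖x‖ u`. -/
def maxLinMap {N : ℕ} (M : Matrix (Fin N) (Fin N) ℝ) (u : Fin N → ℝ)
    (nrm : (Fin N → ℝ) → ℝ) (x : Fin N → ℝ) : Fin N → ℝ :=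
  M *ᵥ x + nrm x • u

/-- The matrix `M + u aᵀ`. -/
def rankOneUpdate {N : ℕ} (M : Matrix (Fin N) (Fin N) ℝ) (u a : Fin N → ℝ) :
    Matrix (Fin N) (Fin N) ℝ :=
  M + Matrix.vecMulVec u a

/-- The set `C_G = {x ≥ 0 | ϱ_G(x) ≤ 1}`. -/
def levelSet {N : ℕ} (G : (Fin N → ℝ) → (Fin N → ℝ)) : Set (Fin N → ℝ) :=
  {x | 0 ≤ x ∧ varrho G x ≤ 1}

/-- The gauge `‖·‖_G`: the Minkowski functional of the convex hull of `C_G ∪ (-C_G)`. -/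
def gaugeNorm {N : ℕ} (G : (Fin N → ℝ) → (Fin N → ℝ)) (x : Fin N → ℝ) : ℝ :=
  gauge (convexHull ℝ (levelSet G ∪ {x | -x ∈ levelSet G})) x

/-- The subdifferential of `h : ℝ^N → ℝ` at `x`. -/
def subdifferential {N : ℕ} (h : (Fin N → ℝ) → ℝ) (x : Fin N → ℝ) : Set (Fin N → ℝ) :=
  {v | ∀ y, (y - x) ⬝ᵥ v + h x ≤ h y}

/-- `ξ` is a positive right eigenvector of `A` for its spectral radius. -/
def IsRightPerron {N : ℕ} (A : Matrix (Fin N) (Fin N) ℝ) (ξ : Fin N → ℝ) : Prop :=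
  (∀ n, 0 < ξ n) ∧ A *ᵥ ξ = matSpecRadius A • ξ

/-- `η` is a positive left eigenvector of `A` for its spectral radius. -/
def IsLeftPerron {N : ℕ} (A : Matrix (Fin N) (Fin N) ℝ) (η : Fin N → ℝ) : Prop :=
  (∀ n, 0 < η n) ∧ η ᵥ* A = matSpecRadius A • η

end

end MaxLin

/-! Write A for the maximizing matrix, r for the spectral radius of diag(s)A and v for the candidate
subgradient. It suffices that v·y ≤ ‖y‖_G for all y, while v·s = r and ‖s‖_G ≤ r. For the upper
bound at s: an eigenvector p of diag(s)G is one of diag(s)M_l for the l attaining ‖p‖, so ϱ_G(s) ≤ r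
(`varrho_maxLinMap_le`) and s/r lies in C_G. For the lower bound: v·x ≤ ϱ_A(x) for x > 0
(`dotProduct_le_matVarrho`). This combines convexity of ϱ_A on the segment from s to x with a
Friedland–Karlin inequality, which replaces differentiating the spectral radius. Since Ap ≤ G(p),
ϱ_A ≤ ϱ_G there, and compactness carries v·x ≤ ϱ_G(x) to the closed orthant
(`dotProduct_le_varrho`). As v ≥ 0, the half-space v·x ≤ 1 then contains C_G and -C_G, hence their
convex hull. -/

namespace MaxLin

open Filter Topology

variable {N : ℕ}

/-! ### Perron–Frobenius theory for monotone homogeneous mappings -/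

/-- A mapping that is monotone and positively homogeneous on the nonnegative orthant. -/
structure IsMonotoneHomogeneous (T : (Fin N → ℝ) → (Fin N → ℝ)) : Prop where
  homog : ∀ (c : ℝ) (x), 0 ≤ c → 0 ≤ x → T (c • x) = c • T x
  mono : ∀ x y, 0 ≤ x → x ≤ y → T x ≤ T y

/-- A continuous mapping that is strongly monotone and positively homogeneous on the nonnegative
orthant. -/
structure IsStronglyMonotoneHomogeneous (T : (Fin N → ℝ) → (Fin N → ℝ)) : Prop
    extends IsMonotoneHomogeneous T where
  strict : ∀ x y, 0 ≤ x → x ≤ y → x ≠ y → ∀ i, T x i < T y i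
  cont : Continuous T

theorem IsMonotoneHomogeneous.map_zero {T : (Fin N → ℝ) → (Fin N → ℝ)}
    (hT : IsMonotoneHomogeneous T) : T 0 = 0 := by
  simpa using hT.homog 0 0 le_rfl le_rfl

theorem IsMonotoneHomogeneous.nonneg {T : (Fin N → ℝ) → (Fin N → ℝ)}
    (hT : IsMonotoneHomogeneous T) {x : Fin N → ℝ} (hx : 0 ≤ x) : 0 ≤ T x := by
  simpa [hT.map_zero] using hT.mono 0 x le_rfl hx

theorem IsStronglyMonotoneHomogeneous.pos {T : (Fin N → ℝ) → (Fin N → ℝ)}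
    (hT : IsStronglyMonotoneHomogeneous T) {x : Fin N → ℝ} (hx : 0 ≤ x) (hx0 : x ≠ 0) (i : Fin N) :
    0 < T x i := by
  simpa [hT.map_zero] using hT.strict 0 x le_rfl hx hx0.symm i

theorem ne_zero_of_mem_stdSimplex {p : Fin N → ℝ} (hp : p ∈ stdSimplex ℝ (Fin N)) : p ≠ 0 := by
  rintro rfl
  simpa using hp.2

/-- Existence of a Collatz–Wielandt maximizer on the simplex. -/
theorem IsStronglyMonotoneHomogeneous.exists_maximizer [Nonempty (Fin N)]
    {T : (Fin N → ℝ) → (Fin N → ℝ)} (hT : IsStronglyMonotoneHomogeneous T) :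
    ∃ c : ℝ, 0 ≤ c ∧ ∃ p ∈ stdSimplex ℝ (Fin N), c • p ≤ T p ∧
      ∀ c' p', 0 ≤ c' → p' ∈ stdSimplex ℝ (Fin N) → c' • p' ≤ T p' → c' ≤ c := by
  have hcont := hT.cont
  have hK := isCompact_stdSimplex ℝ (Fin N)
  obtain ⟨B, hB⟩ := hK.bddAbove_image (f := fun p => ∑ i, T p i) (by fun_prop)
  have key : ∀ c' p', p' ∈ stdSimplex ℝ (Fin N) → c' • p' ≤ T p' → c' ≤ B := by
    intro c' p' hp' h
    calc c' = ∑ i, c' * p' i := by rw [← Finset.mul_sum, hp'.2, mul_one]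
      _ ≤ ∑ i, T p' i := Finset.sum_le_sum fun i _ => h i
      _ ≤ B := hB ⟨p', hp', rfl⟩
  -- `key` bounds c by summing coordinates, so the admissible pairs (c, p) form a compact set.
  have hE : IsCompact ((Set.Icc (0 : ℝ) B ×ˢ stdSimplex ℝ (Fin N)) ∩
      {z : ℝ × (Fin N → ℝ) | z.1 • z.2 ≤ T z.2}) :=
    (isCompact_Icc.prod hK).inter_right (isClosed_le (by fun_prop) (by fun_prop))
  obtain ⟨p₀, hp₀⟩ : (stdSimplex ℝ (Fin N)).Nonempty :=
    ⟨_, single_mem_stdSimplex ℝ (Classical.arbitrary (Fin N))⟩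
  have h₀ : (0 : ℝ) • p₀ ≤ T p₀ := by simpa using hT.nonneg hp₀.1
  obtain ⟨⟨c, p⟩, ⟨⟨hc, hp⟩, hle⟩, hmax⟩ := hE.exists_isMaxOn
    ⟨(0, p₀), ⟨⟨⟨le_rfl, key 0 p₀ hp₀ h₀⟩, hp₀⟩, h₀⟩⟩ (f := Prod.fst) (by fun_prop)
  exact ⟨c, hc.1, p, hp, hle, fun c' p' hc' hp' h =>
    hmax (a := (c', p')) ⟨⟨⟨hc', key c' p' hp' h⟩, hp'⟩, h⟩⟩

/-- A strongly monotone, homogeneous and continuous mapping has a positive eigenvector. -/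
theorem IsStronglyMonotoneHomogeneous.exists_eigenvector [Nonempty (Fin N)]
    {T : (Fin N → ℝ) → (Fin N → ℝ)} (hT : IsStronglyMonotoneHomogeneous T) :
    ∃ c : ℝ, 0 < c ∧ ∃ p : Fin N → ℝ, (∀ i, 0 < p i) ∧ T p = c • p := by
  obtain ⟨c, hc, p, hp, hle, hmax⟩ := hT.exists_maximizer
  have hp0 := ne_zero_of_mem_stdSimplex hp
  have hpos := hT.pos hp.1 hp0
  -- Otherwise strong monotonicity makes c Tp < T(Tp) in every coordinate, and the normalized Tp
  -- admits a larger constant than c.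
  have heq : T p = c • p := by
    by_contra hne
    have hlt : ∀ i, c * T p i < T (T p) i := by
      intro i
      have := hT.strict (c • p) (T p) (smul_nonneg hc hp.1) hle (Ne.symm hne) i
      rwa [hT.homog c p hc hp.1] at this
    obtain ⟨k, hk⟩ := Finite.exists_min fun i => T (T p) i / T p i
    have hck : c < T (T p) k / T p k := (lt_div_iff₀ (hpos k)).2 (hlt k)
    have hS : 0 < ∑ i, T p i := Finset.sum_pos (fun i _ => hpos i) Finset.univ_nonempty
    refine hck.not_ge (hmax _ ((∑ i, T p i)⁻¹ • T p) (hc.trans hck.le) ⟨fun i => ?_, ?_⟩ ?_)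
    · exact mul_nonneg (inv_nonneg.2 hS.le) (hpos i).le
    · simp only [Pi.smul_apply, smul_eq_mul, ← Finset.mul_sum]
      exact inv_mul_cancel₀ hS.ne'
    · rw [hT.homog _ _ (inv_nonneg.2 hS.le) fun i => (hpos i).le, smul_comm]
      refine smul_le_smul_of_nonneg_left (fun i => ?_) (inv_nonneg.2 hS.le)
      exact (le_div_iff₀ (hpos i)).1 (hk i)
  have hcp : ∀ i, 0 < c * p i := fun i => by
    have := hpos i
    rwa [heq] at this
  have hc' : 0 < c := hc.lt_of_ne fun h => by
    simpa [← h] using hcp (Classical.arbitrary (Fin N))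
  exact ⟨c, hc', p, fun i => pos_of_mul_pos_right (hcp i) hc, heq⟩

/-- Collatz–Wielandt upper bound. -/
theorem IsMonotoneHomogeneous.eigenvalue_le {T : (Fin N → ℝ) → (Fin N → ℝ)}
    (hT : IsMonotoneHomogeneous T) {w : Fin N → ℝ} (hw : ∀ i, 0 < w i) {c : ℝ}
    (hwc : T w ≤ c • w) {q : Fin N → ℝ} (hq : 0 ≤ q) (hq0 : q ≠ 0) {m : ℝ} (hqm : T q = m • q) :
    m ≤ c := by
  obtain ⟨j, hj⟩ := Function.ne_iff.1 hq0
  have : Nonempty (Fin N) := ⟨j⟩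
  -- The least multiple of w above q touches it at k; comparing T there gives the bound.
  obtain ⟨k, hk⟩ := Finite.exists_max fun i => q i / w i
  have hjpos : 0 < q j / w j := div_pos ((hq j).lt_of_ne (Ne.symm hj)) (hw j)
  have hkpos : 0 < q k / w k := hjpos.trans_le (hk j)
  have hqk : 0 < q k := by
    have := mul_pos hkpos (hw k)
    rwa [div_mul_cancel₀ _ (hw k).ne'] at this
  have hle : q ≤ (q k / w k) • w := fun i => (div_le_iff₀ (hw i)).1 (hk i)
  have h1 := hT.mono _ _ hq hle k
  rw [hT.homog _ _ hkpos.le fun i => (hw i).le, hqm] at h1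
  have h2 : (q k / w k) * T w k ≤ (q k / w k) * (c * w k) :=
    mul_le_mul_of_nonneg_left (hwc k) hkpos.le
  have h3 : (q k / w k) * (c * w k) = c * q k := by field_simp [(hw k).ne']
  have h4 : m * q k ≤ c * q k := (h1.trans h2).trans_eq h3
  exact le_of_mul_le_mul_right h4 hqk

theorem IsMonotoneHomogeneous.specRadius_le {T : (Fin N → ℝ) → (Fin N → ℝ)}
    (hT : IsMonotoneHomogeneous T) {w : Fin N → ℝ} (hw : ∀ i, 0 < w i) {c : ℝ} (hc : 0 ≤ c)
    (hwc : T w ≤ c • w) : specRadius T ≤ c :=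
  Real.sSup_le (fun _ ⟨_, _, hq, hq0, hqm⟩ => hT.eigenvalue_le hw hwc hq hq0 hqm) hc

theorem IsMonotoneHomogeneous.le_specRadius {T : (Fin N → ℝ) → (Fin N → ℝ)}
    (hT : IsMonotoneHomogeneous T) {q : Fin N → ℝ} (hq : 0 ≤ q) (hq0 : q ≠ 0) {m : ℝ}
    (hm : 0 ≤ m) (hqm : T q = m • q) : m ≤ specRadius T := by
  -- A real `sSup` bounds its elements only if the set is bounded above; testing with the all-ones
  -- vector shows that it is.
  refine le_csSup ⟨∑ i, T 1 i, ?_⟩ ⟨hm, q, hq, hq0, hqm⟩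
  rintro c ⟨-, p, hp, hp0, hpc⟩
  refine hT.eigenvalue_le (w := 1) (fun _ => one_pos) (fun i => ?_) hp hp0 hpc
  simpa using Finset.single_le_sum (f := fun i => T 1 i)
    (fun j _ => hT.nonneg zero_le_one j) (Finset.mem_univ i)

/-- A positive eigenvector serves as test vector for both bounds, so its eigenvalue is the spectral
radius. -/
theorem IsMonotoneHomogeneous.specRadius_eq {T : (Fin N → ℝ) → (Fin N → ℝ)} [Nonempty (Fin N)]
    (hT : IsMonotoneHomogeneous T) {w : Fin N → ℝ} (hw : ∀ i, 0 < w i) {c : ℝ} (hc : 0 ≤ c)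
    (hwc : T w = c • w) : specRadius T = c := by
  refine le_antisymm (hT.specRadius_le hw hc hwc.le)
    (hT.le_specRadius (fun i => (hw i).le) (fun h => ?_) hc hwc)
  simpa [h] using hw (Classical.arbitrary (Fin N))

/-! ### Positive matrices, diagonal scalings and the max-linear mapping -/

theorem isStronglyMonotoneHomogeneous_mulVec {A : Matrix (Fin N) (Fin N) ℝ}
    (hA : ∀ i j, 0 < A i j) : IsStronglyMonotoneHomogeneous fun p => A *ᵥ p where
  homog c x _ _ := Matrix.mulVec_smul A c x
  mono x y _ h i :=
    dotProduct_le_dotProduct_of_nonneg_left h fun j => (hA i j).le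
  strict x y _ h hne i := by
    obtain ⟨j, hj⟩ := Function.ne_iff.1 hne
    exact Finset.sum_lt_sum (fun j _ => mul_le_mul_of_nonneg_left (h j) (hA i j).le)
      ⟨j, Finset.mem_univ j, mul_lt_mul_of_pos_left ((h j).lt_of_ne hj) (hA i j)⟩
  cont := by fun_prop

theorem IsMonotoneHomogeneous.diagonal {T : (Fin N → ℝ) → (Fin N → ℝ)}
    (hT : IsMonotoneHomogeneous T) {x : Fin N → ℝ} (hx : 0 ≤ x) :
    IsMonotoneHomogeneous fun p => Matrix.diagonal x *ᵥ T p where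
  homog c p hc hp := by rw [hT.homog c p hc hp, Matrix.mulVec_smul]
  mono p q hp h i := by
    simpa [Matrix.mulVec_diagonal] using mul_le_mul_of_nonneg_left (hT.mono p q hp h i) (hx i)

theorem IsStronglyMonotoneHomogeneous.diagonal {T : (Fin N → ℝ) → (Fin N → ℝ)}
    (hT : IsStronglyMonotoneHomogeneous T) {x : Fin N → ℝ} (hx : ∀ i, 0 < x i) :
    IsStronglyMonotoneHomogeneous fun p => Matrix.diagonal x *ᵥ T p where
  toIsMonotoneHomogeneous := hT.toIsMonotoneHomogeneous.diagonal fun i => (hx i).le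
  strict p q hp h hne i := by
    simpa [Matrix.mulVec_diagonal] using mul_lt_mul_of_pos_left (hT.strict p q hp h hne i) (hx i)
  cont := by
    have := hT.cont
    fun_prop

theorem IsPolyhedralNorm.continuous {L : ℕ} {nrm : (Fin N → ℝ) → ℝ} {a : Fin L → Fin N → ℝ}
    (h : IsPolyhedralNorm nrm a) : Continuous nrm := by
  obtain ⟨l, -⟩ := (h.eq_max 0).1
  have hne : (Finset.univ : Finset (Fin L)).Nonempty := ⟨l, Finset.mem_univ l⟩
  have heq : nrm = fun x => Finset.univ.sup' hne fun l => a l ⬝ᵥ |x| := by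
    funext x
    refine le_antisymm ?_ (Finset.sup'_le _ _ fun l _ => (h.eq_max x).2 ⟨l, rfl⟩)
    obtain ⟨k, hk⟩ := (h.eq_max x).1
    rw [← hk]
    exact Finset.le_sup' (fun l => a l ⬝ᵥ |x|) (Finset.mem_univ k)
  rw [heq]
  refine Continuous.finset_sup'_apply hne fun l _ => ?_
  have : Continuous fun x : Fin N → ℝ => |x| :=
    continuous_pi fun i => (continuous_apply i).abs
  exact continuous_const.dotProduct this

theorem isStronglyMonotoneHomogeneous_maxLinMap {L : ℕ} {M : Matrix (Fin N) (Fin N) ℝ}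
    (hM : ∀ i j, 0 < M i j) {u : Fin N → ℝ} (hu : ∀ n, 0 < u n) {nrm : (Fin N → ℝ) → ℝ}
    {a : Fin L → Fin N → ℝ} (h : IsPolyhedralNorm nrm a) :
    IsStronglyMonotoneHomogeneous (maxLinMap M u nrm) where
  homog c x hc hx := by
    simp only [maxLinMap, Matrix.mulVec_smul, h.smul, abs_of_nonneg hc, smul_add, mul_smul]
  mono x y hx hxy i := by
    have h1 := (isStronglyMonotoneHomogeneous_mulVec hM).mono x y hx hxy i
    have h2 := mul_le_mul_of_nonneg_right (h.mono x y hx hxy) (hu i).le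
    exact add_le_add h1 h2
  strict x y hx hxy hne i := by
    have h1 := (isStronglyMonotoneHomogeneous_mulVec hM).strict x y hx hxy hne i
    have h2 := mul_le_mul_of_nonneg_right (h.mono x y hx hxy) (hu i).le
    exact add_lt_add_of_lt_of_le h1 h2
  cont := by
    have := h.continuous
    unfold maxLinMap
    fun_prop

theorem rankOneUpdate_mulVec (M : Matrix (Fin N) (Fin N) ℝ) (u a p : Fin N → ℝ) :
    rankOneUpdate M u a *ᵥ p = M *ᵥ p + (a ⬝ᵥ p) • u := by
  ext i
  simp [rankOneUpdate, Matrix.add_mulVec, Matrix.vecMulVec_mulVec, mul_comm]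

theorem rankOneUpdate_pos {M : Matrix (Fin N) (Fin N) ℝ} (hM : ∀ i j, 0 < M i j)
    {u a : Fin N → ℝ} (hu : ∀ n, 0 < u n) (ha : 0 ≤ a) (i j : Fin N) :
    0 < rankOneUpdate M u a i j :=
  add_pos_of_pos_of_nonneg (hM i j) (mul_nonneg (hu i).le (ha j))

theorem rankOneUpdate_mulVec_le_maxLinMap {L : ℕ} {M : Matrix (Fin N) (Fin N) ℝ}
    {u : Fin N → ℝ} (hu : ∀ n, 0 < u n) {nrm : (Fin N → ℝ) → ℝ} {a : Fin L → Fin N → ℝ}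
    (h : IsPolyhedralNorm nrm a) (l : Fin L) {p : Fin N → ℝ} (hp : 0 ≤ p) :
    rankOneUpdate M u (a l) *ᵥ p ≤ maxLinMap M u nrm p := by
  rw [rankOneUpdate_mulVec, maxLinMap]
  have := (h.eq_max p).2 ⟨l, rfl⟩
  rw [abs_of_nonneg hp] at this
  gcongr
  exact fun i => (hu i).le

/-- With the preceding inequality, this makes G on the orthant the attained pointwise maximum of the
linear mappings M_l. -/
theorem exists_maxLinMap_eq {L : ℕ} (M : Matrix (Fin N) (Fin N) ℝ)
    (u : Fin N → ℝ) {nrm : (Fin N → ℝ) → ℝ} {a : Fin L → Fin N → ℝ}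
    (h : IsPolyhedralNorm nrm a) {p : Fin N → ℝ} (hp : 0 ≤ p) :
    ∃ l, maxLinMap M u nrm p = rankOneUpdate M u (a l) *ᵥ p := by
  obtain ⟨l, hl⟩ := (h.eq_max p).1
  refine ⟨l, ?_⟩
  simp only [abs_of_nonneg hp] at hl
  rw [rankOneUpdate_mulVec, maxLinMap, hl]

theorem matVarrho_eq (A : Matrix (Fin N) (Fin N) ℝ) (x : Fin N → ℝ) :
    matVarrho A x = matSpecRadius (Matrix.diagonal x * A) := by
  simp [matVarrho, varrho, matSpecRadius, Matrix.mulVec_mulVec]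

/-! ### Subgradients of the spectral radius of a positive matrix -/

/-- Friedland–Karlin type inequality for the Collatz–Wielandt quotients of a positive vector. -/
theorem mul_dotProduct_le_sum_quotient {A : Matrix (Fin N) (Fin N) ℝ} (hA : ∀ i j, 0 ≤ A i j)
    {ξ η : Fin N → ℝ} (hξ : ∀ i, 0 < ξ i) (hη : ∀ i, 0 < η i) {r : ℝ}
    (hr : A *ᵥ ξ = r • ξ) (hl : η ᵥ* A = r • η) {w : Fin N → ℝ} (hw : ∀ i, 0 < w i) :
    r * (η ⬝ᵥ ξ) ≤ ∑ i, η i * ξ i * ((A *ᵥ w) i / w i) := by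
  -- The weights η_i A_ij ξ_j have i-th row and column sums both equal to r η_i ξ_i, so the terms
  -- z_j - z_i cancel in the weighted sum; then 1 + log q ≤ q is applied termwise.
  set z : Fin N → ℝ := fun i => Real.log (w i / ξ i) with hz
  have hr' : ∀ i, ∑ j, A i j * ξ j = r * ξ i := fun i => congrFun hr i
  have hl' : ∀ j, ∑ i, η i * A i j = r * η j := fun j => congrFun hl j
  have h1 : ∑ i, ∑ j, η i * (A i j * ξ j) * (1 - z i) = ∑ i, η i * (r * ξ i) * (1 - z i) :=
    Finset.sum_congr rfl fun i _ => by rw [← Finset.sum_mul, ← Finset.mul_sum, hr']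
  have h2 : ∑ i, ∑ j, η i * A i j * (ξ j * z j) = ∑ j, r * η j * (ξ j * z j) := by
    rw [Finset.sum_comm]
    exact Finset.sum_congr rfl fun j _ => by rw [← Finset.sum_mul, hl']
  calc r * (η ⬝ᵥ ξ) = ∑ i, η i * (r * ξ i) * (1 - z i) + ∑ j, r * η j * (ξ j * z j) := by
        rw [dotProduct, Finset.mul_sum, ← Finset.sum_add_distrib]
        exact Finset.sum_congr rfl fun i _ => by ring
    _ = ∑ i, ∑ j, η i * A i j * ξ j * (1 + (z j - z i)) := by
        rw [← h1, ← h2, ← Finset.sum_add_distrib]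
        refine Finset.sum_congr rfl fun i _ => ?_
        rw [← Finset.sum_add_distrib]
        exact Finset.sum_congr rfl fun j _ => by ring
    _ ≤ ∑ i, ∑ j, η i * A i j * ξ j * ((w j / ξ j) / (w i / ξ i)) := by
        refine Finset.sum_le_sum fun i _ => Finset.sum_le_sum fun j _ => ?_
        refine mul_le_mul_of_nonneg_left ?_
          (mul_nonneg (mul_nonneg (hη i).le (hA i j)) (hξ j).le)
        have hi := div_pos (hw i) (hξ i)
        have hj := div_pos (hw j) (hξ j)
        rw [hz, ← Real.log_div hj.ne' hi.ne']
        linarith [Real.log_le_sub_one_of_pos (div_pos hj hi)]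
    _ = ∑ i, η i * ξ i * ((A *ᵥ w) i / w i) := by
        refine Finset.sum_congr rfl fun i _ => ?_
        rw [Matrix.mulVec, dotProduct, Finset.sum_div, Finset.mul_sum]
        refine Finset.sum_congr rfl fun j _ => ?_
        have := (hξ j).ne'
        have := (hξ i).ne'
        have := (hw i).ne'
        field_simp

/-- The first-order bound extracted from a lower bound along a segment. -/
theorem sum_mul_le_of_forall_small {α e : Fin N → ℝ} {r f : ℝ}
    (he : ∀ i, -1 < e i)
    (h : ∀ t : ℝ, 0 < t → t < 1 →
      r * ∑ i, α i ≤ ((1 - t) * r + t * f) * ∑ i, α i / (1 + t * e i)) :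
    r * ∑ i, α i * (1 + e i) ≤ f * ∑ i, α i := by
  have hpos : ∀ t : ℝ, 0 < t → t < 1 → ∀ i, 0 < 1 + t * e i := fun t h0 h1 i => by
    nlinarith [he i]
  have key : ∀ t : ℝ, 0 < t → t < 1 →
      r * ∑ i, α i * e i / (1 + t * e i) ≤ (f - r) * ∑ i, α i / (1 + t * e i) := by
    intro t h0 h1
    -- This splitting cancels the zeroth-order terms, so that a factor t can be divided out before t
    -- → 0.
    have h2 : ∑ i, α i = ∑ i, α i / (1 + t * e i) + t * ∑ i, α i * e i / (1 + t * e i) := by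
      rw [Finset.mul_sum, ← Finset.sum_add_distrib]
      refine Finset.sum_congr rfl fun i _ => ?_
      have := (hpos t h0 h1 i).ne'
      field_simp
    have h3 := h t h0 h1
    rw [h2] at h3
    refine le_of_mul_le_mul_left ?_ h0
    linarith
  have hlim : ∀ β : Fin N → ℝ,
      Tendsto (fun t : ℝ => ∑ i, β i / (1 + t * e i)) (𝓝[>] 0) (𝓝 (∑ i, β i)) := by
    intro β
    have hc : ContinuousAt (fun t : ℝ => ∑ i, β i / (1 + t * e i)) 0 := by
      refine tendsto_finsetSum _ fun i _ => ContinuousAt.div (by fun_prop) (by fun_prop) (by simp)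
    simpa using hc.tendsto.mono_left nhdsWithin_le_nhds
  have := le_of_tendsto_of_tendsto ((hlim fun i => α i * e i).const_mul r)
    ((hlim α).const_mul (f - r)) (by
      filter_upwards [Ioo_mem_nhdsGT (zero_lt_one' ℝ)] with t ht
      exact key t ht.1 ht.2)
  simp only [mul_add, mul_one, Finset.sum_add_distrib]
  linarith

/-- The candidate subgradient is a subgradient of the spectral radius function of a positive
matrix, provided that the latter is convex. -/
theorem dotProduct_le_matVarrho [Nonempty (Fin N)] {A : Matrix (Fin N) (Fin N) ℝ}
    (hA : ∀ i j, 0 < A i j)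
    (hconv : ConvexOn ℝ {x : Fin N → ℝ | ∀ n, 0 < x n} (matVarrho A))
    {s ξ η : Fin N → ℝ} (hs : ∀ i, 0 < s i)
    (hξ : IsRightPerron (Matrix.diagonal s * A) ξ) (hη : IsLeftPerron (Matrix.diagonal s * A) η)
    {x : Fin N → ℝ} (hx : ∀ i, 0 < x i) :
    x ⬝ᵥ ((η ⬝ᵥ ξ)⁻¹ • (Matrix.diagonal η *ᵥ (A *ᵥ ξ))) ≤ matVarrho A x := by
  have hpos : 0 < η ⬝ᵥ ξ :=
    Finset.sum_pos (fun i _ => mul_pos (hη.1 i) (hξ.1 i)) Finset.univ_nonempty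
  have hAs := isStronglyMonotoneHomogeneous_mulVec hA
  set r := matSpecRadius (Matrix.diagonal s * A) with hr
  have hξ' : ∀ i, s i * (A *ᵥ ξ) i = r * ξ i := fun i => by
    have := congrFun hξ.2 i
    rwa [← Matrix.mulVec_mulVec, Matrix.mulVec_diagonal] at this
  have main := sum_mul_le_of_forall_small (α := fun i => η i * ξ i) (e := fun i => x i / s i - 1)
    (r := r) (f := matVarrho A x) (fun i => by have := div_pos (hx i) (hs i); linarith) (by
      intro t h0 h1
      set y : Fin N → ℝ := (1 - t) • s + t • x with hy
      have hypos : ∀ i, 0 < y i := fun i =>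
        add_pos (mul_pos (sub_pos.2 h1) (hs i)) (mul_pos h0 (hx i))
      have hyA := hAs.diagonal hypos
      -- For the Perron vector w at y, the quotients of diag(s)A are c s_i / y_i = c / (1 + t e_i),
      -- with e_i = x_i / s_i - 1.
      obtain ⟨c, hc, w, hw, hwc⟩ := hyA.exists_eigenvector
      have hcy : matVarrho A y = c := hyA.specRadius_eq hw hc.le hwc
      have hle : c ≤ (1 - t) * r + t * matVarrho A x := by
        rw [← hcy, hr, ← matVarrho_eq]
        exact hconv.2 hs hx (sub_nonneg.2 h1.le) h0.le (by ring)
      have hwc' : ∀ i, y i * (A *ᵥ w) i = c * w i := fun i => by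
        have := congrFun hwc i
        rwa [Matrix.mulVec_diagonal] at this
      have hye : ∀ i, s i * (1 + t * (x i / s i - 1)) = y i := fun i => by
        have := (hs i).ne'
        simp only [hy, Pi.add_apply, Pi.smul_apply, smul_eq_mul]
        field_simp
        ring
      have hepos : ∀ i, 0 < 1 + t * (x i / s i - 1) := fun i => by
        have := hypos i
        rw [← hye] at this
        exact pos_of_mul_pos_right this (hs i).le
      calc r * ∑ i, η i * ξ i
          ≤ ∑ i, η i * ξ i * (((Matrix.diagonal s * A) *ᵥ w) i / w i) :=
            mul_dotProduct_le_sum_quotient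
              (fun i j => by
                rw [Matrix.diagonal_mul]
                exact (mul_pos (hs i) (hA i j)).le) hξ.1 hη.1 hξ.2 hη.2 hw
        _ = c * ∑ i, η i * ξ i / (1 + t * (x i / s i - 1)) := by
            rw [Finset.mul_sum]
            refine Finset.sum_congr rfl fun i _ => ?_
            have h2 : s i * (A *ᵥ w) i / w i = c / (1 + t * (x i / s i - 1)) := by
              rw [div_eq_div_iff (hw i).ne' (hepos i).ne', ← hwc', ← hye]
              ring
            rw [← Matrix.mulVec_mulVec, Matrix.mulVec_diagonal, h2]
            ring
        _ ≤ _ := mul_le_mul_of_nonneg_right hle (Finset.sum_nonneg fun i _ =>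
            div_nonneg (mul_pos (hη.1 i) (hξ.1 i)).le (hepos i).le))
  rw [dotProduct_smul, smul_eq_mul, inv_mul_le_iff₀ hpos, mul_comm]
  refine le_of_eq_of_le ?_ main
  rw [dotProduct, Finset.mul_sum]
  refine Finset.sum_congr rfl fun i _ => ?_
  rw [Matrix.mulVec_diagonal]
  have h := hξ' i
  have hsi := (hs i).ne'
  calc x i * (η i * (A *ᵥ ξ) i) = x i * η i * (s i * (A *ᵥ ξ) i) / s i := by field_simp
    _ = _ := by rw [h]; ring

theorem dotProduct_perron_eq {A : Matrix (Fin N) (Fin N) ℝ} [Nonempty (Fin N)] {s ξ η : Fin N → ℝ}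
    (hξ : IsRightPerron (Matrix.diagonal s * A) ξ) (hη : ∀ i, 0 < η i) :
    s ⬝ᵥ ((η ⬝ᵥ ξ)⁻¹ • (Matrix.diagonal η *ᵥ (A *ᵥ ξ))) =
      matSpecRadius (Matrix.diagonal s * A) := by
  have hpos : 0 < η ⬝ᵥ ξ :=
    Finset.sum_pos (fun i _ => mul_pos (hη i) (hξ.1 i)) Finset.univ_nonempty
  rw [dotProduct_smul, smul_eq_mul, inv_mul_eq_iff_eq_mul₀ hpos.ne', dotProduct, dotProduct,
    Finset.sum_mul]
  refine Finset.sum_congr rfl fun i _ => ?_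
  have := congrFun hξ.2 i
  rw [← Matrix.mulVec_mulVec, Matrix.mulVec_diagonal, Pi.smul_apply, smul_eq_mul] at this
  rw [Matrix.mulVec_diagonal]
  linear_combination η i * this

/-! ### Passage to the boundary and comparison of mappings -/

/-- A linear lower bound for the spectral radius function of `T` on the open orthant extends to
the closed one. -/
theorem dotProduct_le_varrho {T : (Fin N → ℝ) → (Fin N → ℝ)} [Nonempty (Fin N)]
    (hT : IsStronglyMonotoneHomogeneous T) {v : Fin N → ℝ}
    (hv : ∀ x : Fin N → ℝ, (∀ i, 0 < x i) → x ⬝ᵥ v ≤ varrho T x) {x : Fin N → ℝ} (hx : 0 ≤ x) :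
    x ⬝ᵥ v ≤ varrho T x := by
  have hcont := hT.cont
  -- Since the coordinates of p sum to one, its eigenvalue must be the sum of the y_i T(p)_i; P is
  -- thus described by closed conditions without a separate eigenvalue variable.
  set P : Set ((Fin N → ℝ) × (Fin N → ℝ)) := {z | z.2 ∈ stdSimplex ℝ (Fin N) ∧
    (fun i => z.1 i * T z.2 i) = (∑ i, z.1 i * T z.2 i) • z.2 ∧
    z.1 ⬝ᵥ v ≤ ∑ i, z.1 i * T z.2 i} with hP
  have hclosed : IsClosed P := by
    refine ((isCompact_stdSimplex ℝ (Fin N)).isClosed.preimage continuous_snd).inter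
      (IsClosed.inter ?_ ?_)
    · exact isClosed_eq (by fun_prop) (by fun_prop)
    · exact isClosed_le (continuous_fst.dotProduct continuous_const) (by fun_prop)
  -- Projection along the compact simplex is a closed map.
  have hproj : IsClosed {y : Fin N → ℝ | ∃ p, (y, p) ∈ P} := by
    have hK : CompactSpace (stdSimplex ℝ (Fin N)) :=
      isCompact_iff_compactSpace.1 (isCompact_stdSimplex ℝ (Fin N))
    have h1 := isClosedMap_fst_of_compactSpace (X := Fin N → ℝ) (Y := stdSimplex ℝ (Fin N)) _
      (hclosed.preimage (f := fun z : (Fin N → ℝ) × stdSimplex ℝ (Fin N) => (z.1, z.2.1))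
        (by fun_prop))
    convert h1 using 1
    ext y
    constructor
    · rintro ⟨p, hp⟩
      exact ⟨(y, ⟨p, hp.1⟩), hp, rfl⟩
    · rintro ⟨⟨y, p⟩, hp, rfl⟩
      exact ⟨p.1, hp⟩
  have hopen : ∀ y : Fin N → ℝ, (∀ i, 0 < y i) → ∃ p, (y, p) ∈ P := by
    intro y hy
    have hyT := hT.diagonal hy
    obtain ⟨c, hc, w, hw, hwc⟩ := hyT.exists_eigenvector
    have hS : 0 < ∑ i, w i := Finset.sum_pos (fun i _ => hw i) Finset.univ_nonempty
    set p := (∑ i, w i)⁻¹ • w with hp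
    have hpK : p ∈ stdSimplex ℝ (Fin N) := by
      refine ⟨fun i => mul_nonneg (inv_nonneg.2 hS.le) (hw i).le, ?_⟩
      simp only [hp, Pi.smul_apply, smul_eq_mul, ← Finset.mul_sum]
      exact inv_mul_cancel₀ hS.ne'
    have hpc : (fun i => y i * T p i) = c • p := by
      have h1 := hyT.homog _ w (inv_nonneg.2 hS.le) fun i => (hw i).le
      rw [hwc, smul_comm, ← hp] at h1
      rw [← h1]
      ext i
      rw [Matrix.mulVec_diagonal]
    have hsum : ∑ i, y i * T p i = c := by
      calc ∑ i, y i * T p i = ∑ i, c * p i := Finset.sum_congr rfl fun i _ => congrFun hpc i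
        _ = c := by rw [← Finset.mul_sum, hpK.2, mul_one]
    refine ⟨p, hpK, by rw [hsum]; exact hpc, ?_⟩
    have := hv y hy
    rw [varrho, hyT.specRadius_eq hw hc.le hwc] at this
    rwa [← hsum] at this
  have hxmem : x ∈ {y : Fin N → ℝ | ∃ p, (y, p) ∈ P} := by
    have hlim : Tendsto (fun t : ℝ => x + t • (1 : Fin N → ℝ)) (𝓝[>] 0) (𝓝 x) := by
      have h1 : Continuous fun t : ℝ => x + t • (1 : Fin N → ℝ) := by fun_prop
      simpa using (h1.tendsto 0).mono_left nhdsWithin_le_nhds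
    refine hproj.mem_of_tendsto hlim ?_
    filter_upwards [self_mem_nhdsWithin] with t ht
    refine hopen _ fun i => ?_
    simpa using add_pos_of_nonneg_of_pos (hx i) ht
  obtain ⟨p, hpK, hpe, hle⟩ := hxmem
  refine hle.trans ((hT.toIsMonotoneHomogeneous.diagonal hx).le_specRadius hpK.1
    (ne_zero_of_mem_stdSimplex hpK) (Finset.sum_nonneg fun i _ =>
      mul_nonneg (hx i) (hT.nonneg hpK.1 i)) ?_)
  refine Eq.trans ?_ hpe
  ext i
  exact Matrix.mulVec_diagonal _ _ i

/-- The spectral radius functions are monotone in the mapping. -/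
theorem varrho_le_varrho {T U : (Fin N → ℝ) → (Fin N → ℝ)} [Nonempty (Fin N)]
    (hT : IsMonotoneHomogeneous T) (hU : IsStronglyMonotoneHomogeneous U)
    (h : ∀ p, 0 ≤ p → T p ≤ U p) {x : Fin N → ℝ} (hx : ∀ i, 0 < x i) :
    varrho T x ≤ varrho U x := by
  have hxU := hU.diagonal hx
  obtain ⟨c, hc, w, hw, hwc⟩ := hxU.exists_eigenvector
  rw [varrho, varrho, hxU.specRadius_eq hw hc.le hwc]
  refine (hT.diagonal fun i => (hx i).le).specRadius_le hw hc.le fun i => ?_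
  rw [← hwc, Matrix.mulVec_diagonal, Matrix.mulVec_diagonal]
  exact mul_le_mul_of_nonneg_left (h w (fun i => (hw i).le) i) (hx i).le

/-! ### The gauge of the symmetrized level set -/

/-- The level set contains an order interval below any positive vector. -/
theorem mem_levelSet_of_le {T : (Fin N → ℝ) → (Fin N → ℝ)} [Nonempty (Fin N)]
    (hT : IsStronglyMonotoneHomogeneous T) {s : Fin N → ℝ} (hs : ∀ i, 0 < s i) {r : ℝ}
    (hr : 0 < r) (hsr : varrho T s ≤ r) {x : Fin N → ℝ} (hx : 0 ≤ x) (hxs : r • x ≤ s) :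
    x ∈ levelSet T := by
  have hsT := hT.diagonal hs
  obtain ⟨c, hc, w, hw, hwc⟩ := hsT.exists_eigenvector
  rw [varrho, hsT.specRadius_eq hw hc.le hwc] at hsr
  -- The eigenvector w at s tests diag(x)T: coordinatewise, r x T(w) ≤ s T(w) = c w ≤ r w.
  refine ⟨hx, (hT.toIsMonotoneHomogeneous.diagonal hx).specRadius_le hw zero_le_one fun i => ?_⟩
  have h1 := congrFun hwc i
  simp only [Matrix.mulVec_diagonal, Pi.smul_apply, smul_eq_mul, one_mul] at h1 ⊢
  have h2 : r * (x i * T w i) ≤ r * w i := by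
    calc r * (x i * T w i) = r * x i * T w i := by ring
      _ ≤ s i * T w i := mul_le_mul_of_nonneg_right (hxs i) (hT.nonneg (fun i => (hw i).le) i)
      _ = c * w i := h1
      _ ≤ r * w i := mul_le_mul_of_nonneg_right hsr (hw i).le
  exact le_of_mul_le_mul_left h2 hr

/-- A small y is the midpoint of 2y⁺ in the level set and -2y⁻ in its reflection. Absorbency is what
makes the gauge subadditive and its defining infimum nonvacuous. -/
theorem absorbent_convexHull_levelSet {T : (Fin N → ℝ) → (Fin N → ℝ)} [Nonempty (Fin N)]
    (hT : IsStronglyMonotoneHomogeneous T) :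
    Absorbent ℝ (convexHull ℝ (levelSet T ∪ {x | -x ∈ levelSet T})) := by
  -- The maximum with 1 only secures r > 0.
  set r := max 1 (varrho T 1) with hr
  have hr0 : 0 < r := zero_lt_one.trans_le (le_max_left _ _)
  have hmem : ∀ y : Fin N → ℝ, 0 ≤ y → r • y ≤ 1 → y ∈ levelSet T := fun y h0 h1 =>
    mem_levelSet_of_le hT (s := 1) (fun _ => one_pos) hr0 (le_max_right _ _) h0 h1
  refine absorbent_nhds_zero (mem_of_superset
    (Metric.ball_mem_nhds 0 (ε := (2 * r)⁻¹) (by positivity)) fun y hy => ?_)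
  have hyi : ∀ i, r * (2 * |y i|) ≤ 1 := fun i => by
    have h1 := (norm_le_pi_norm y i).trans (mem_ball_zero_iff.1 hy).le
    rw [Real.norm_eq_abs] at h1
    calc r * (2 * |y i|) = (2 * r) * |y i| := by ring
      _ ≤ (2 * r) * (2 * r)⁻¹ := mul_le_mul_of_nonneg_left h1 (by positivity)
      _ = 1 := mul_inv_cancel₀ (by positivity)
  have hy1 : (fun i => 2 * max (y i) 0) ∈ levelSet T :=
    hmem _ (fun i => by simp) fun i => (mul_le_mul_of_nonneg_left
      (mul_le_mul_of_nonneg_left (max_le (le_abs_self _) (abs_nonneg _)) zero_le_two)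
      hr0.le).trans (hyi i)
  have hy2 : (fun i => 2 * max (-y i) 0) ∈ levelSet T :=
    hmem _ (fun i => by simp) fun i => (mul_le_mul_of_nonneg_left
      (mul_le_mul_of_nonneg_left (max_le (neg_le_abs _) (abs_nonneg _)) zero_le_two)
      hr0.le).trans (hyi i)
  have h3 := convex_convexHull ℝ (levelSet T ∪ {x | -x ∈ levelSet T})
    (subset_convexHull ℝ _ (Or.inl hy1))
    (subset_convexHull ℝ _ (Or.inr (show -(-fun i => 2 * max (-y i) 0) ∈ levelSet T by
      rwa [neg_neg])))
    (a := 1 / 2) (b := 1 / 2) (by norm_num) (by norm_num) (by norm_num)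
  convert h3 using 1
  ext i
  simp only [Pi.add_apply, Pi.smul_apply, Pi.neg_apply, smul_eq_mul]
  rcases le_total (y i) 0 with h | h
  · rw [max_eq_right h, max_eq_left (neg_nonneg.2 h)]
    ring
  · rw [max_eq_left h, max_eq_right (neg_nonpos.2 h)]
    ring

theorem convexOn_gaugeNorm {T : (Fin N → ℝ) → (Fin N → ℝ)} [Nonempty (Fin N)]
    (hT : IsStronglyMonotoneHomogeneous T) : ConvexOn ℝ Set.univ (gaugeNorm T) := by
  refine ⟨convex_univ, fun x _ y _ b c hb hc _ => ?_⟩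
  refine (gauge_add_le (convex_convexHull ℝ _) (absorbent_convexHull_levelSet hT) _ _).trans ?_
  rw [gauge_smul_of_nonneg hb, gauge_smul_of_nonneg hc]
  rfl

/-- A nonnegative functional dominated by the spectral radius function is dominated by the
gauge. -/
theorem dotProduct_le_gaugeNorm {T : (Fin N → ℝ) → (Fin N → ℝ)} [Nonempty (Fin N)]
    (hT : IsStronglyMonotoneHomogeneous T) {v : Fin N → ℝ} (hv0 : 0 ≤ v)
    (hv : ∀ x : Fin N → ℝ, 0 ≤ x → x ⬝ᵥ v ≤ varrho T x) (y : Fin N → ℝ) :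
    y ⬝ᵥ v ≤ gaugeNorm T y := by
  have hsub : convexHull ℝ (levelSet T ∪ {x | -x ∈ levelSet T}) ⊆ {x | x ⬝ᵥ v ≤ 1} := by
    refine convexHull_min ?_ ?_
    · rintro x (hx | hx)
      · exact (hv x hx.1).trans hx.2
      -- On the reflected set v ≥ 0 makes the functional nonpositive.
      · have h1 := dotProduct_nonneg_of_nonneg hx.1 hv0
        rw [neg_dotProduct] at h1
        exact (neg_nonneg.1 h1).trans zero_le_one
    · exact convex_halfSpace_le ⟨fun x y => add_dotProduct x y v, fun c x => smul_dotProduct c x v⟩ 1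
  refine le_csInf (absorbent_convexHull_levelSet hT).gauge_set_nonempty ?_
  rintro c ⟨hc, x, hx, rfl⟩
  have h1 : x ⬝ᵥ v ≤ 1 := hsub hx
  simpa [smul_dotProduct] using mul_le_mul_of_nonneg_left h1 (le_of_lt hc)

theorem gaugeNorm_le {T : (Fin N → ℝ) → (Fin N → ℝ)} [Nonempty (Fin N)]
    (hT : IsStronglyMonotoneHomogeneous T) {s : Fin N → ℝ} (hs : ∀ i, 0 < s i) {r : ℝ}
    (hr : 0 < r) (hsr : varrho T s ≤ r) : gaugeNorm T s ≤ r := by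
  refine gauge_le_of_mem hr.le ⟨r⁻¹ • s, subset_convexHull ℝ _ (Or.inl ?_), ?_⟩
  · exact mem_levelSet_of_le hT hs hr hsr
      (fun i => mul_nonneg (inv_nonneg.2 hr.le) (hs i).le) (smul_inv_smul₀ hr.ne' s).le
  · exact smul_inv_smul₀ hr.ne' s

/-! ### Perron eigenvectors and the spectral radius of the max-linear mapping -/

/-- Perron's theorem: right eigenvector. -/
theorem exists_isRightPerron [Nonempty (Fin N)] {A : Matrix (Fin N) (Fin N) ℝ}
    (hA : ∀ i j, 0 < A i j) : 0 < matSpecRadius A ∧ ∃ ξ, IsRightPerron A ξ := by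
  have hT := isStronglyMonotoneHomogeneous_mulVec hA
  obtain ⟨c, hc, w, hw, hwc⟩ := hT.exists_eigenvector
  have h : matSpecRadius A = c := hT.specRadius_eq hw hc.le hwc
  exact ⟨h ▸ hc, w, hw, h ▸ hwc⟩

/-- Perron's theorem: left eigenvector. -/
theorem exists_isLeftPerron [Nonempty (Fin N)] {A : Matrix (Fin N) (Fin N) ℝ}
    (hA : ∀ i j, 0 < A i j) : ∃ η, IsLeftPerron A η := by
  obtain ⟨-, ξ, hξ, hξA⟩ := exists_isRightPerron hA
  obtain ⟨-, η, hη, hηA⟩ := exists_isRightPerron (A := A.transpose) fun i j => hA j i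
  rw [Matrix.mulVec_transpose] at hηA
  -- So far η belongs to the spectral radius of the transpose; pairing with ξ > 0 identifies the two
  -- values.
  have h1 : (η ᵥ* A) ⬝ᵥ ξ = η ⬝ᵥ (A *ᵥ ξ) := (Matrix.dotProduct_mulVec η A ξ).symm
  have hpos : 0 < η ⬝ᵥ ξ := Finset.sum_pos (fun i _ => mul_pos (hη i) (hξ i)) Finset.univ_nonempty
  rw [hηA, hξA, smul_dotProduct, dotProduct_smul, smul_eq_mul, smul_eq_mul] at h1
  exact ⟨η, hη, by rw [hηA, mul_right_cancel₀ hpos.ne' h1]⟩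

/-- The spectral radius function of the max-linear mapping is at most the largest one of the
linear mappings `M + u (a l)ᵀ`. -/
theorem varrho_maxLinMap_le {L : ℕ} {M : Matrix (Fin N) (Fin N) ℝ} (hM : ∀ i j, 0 < M i j)
    {u : Fin N → ℝ} (hu : ∀ n, 0 < u n) {nrm : (Fin N → ℝ) → ℝ} {a : Fin L → Fin N → ℝ}
    (h : IsPolyhedralNorm nrm a) {s : Fin N → ℝ} (hs : 0 ≤ s) {r : ℝ} (hr : 0 ≤ r)
    (hl : ∀ l, matVarrho (rankOneUpdate M u (a l)) s ≤ r) :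
    varrho (maxLinMap M u nrm) s ≤ r := by
  refine Real.sSup_le ?_ hr
  rintro c ⟨hc, p, hp, hp0, hpc⟩
  obtain ⟨l, hpl⟩ := exists_maxLinMap_eq M u h hp
  have hA := (isStronglyMonotoneHomogeneous_mulVec
    (rankOneUpdate_pos hM hu (h.nonneg l))).toIsMonotoneHomogeneous.diagonal hs
  exact (hA.le_specRadius hp hp0 hc (by rw [← hpl]; exact hpc)).trans (hl l)

end MaxLin

theorem proposition4 {N L : ℕ}
    (M : Matrix (Fin N) (Fin N) ℝ) (hM : ∀ i j, 0 < M i j)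
    (u : Fin N → ℝ) (hu : ∀ n, 0 < u n)
    (nrm : (Fin N → ℝ) → ℝ) (a : Fin L → Fin N → ℝ)
    (hnrm : MaxLin.IsPolyhedralNorm nrm a)
    (hconv : ∀ l, ConvexOn ℝ {x : Fin N → ℝ | ∀ n, 0 < x n}
      (MaxLin.matVarrho (MaxLin.rankOneUpdate M u (a l))))
    (s : Fin N → ℝ) (hs : ∀ n, 0 < s n)
    (lstar : Fin L)
    (hl : ∀ l, MaxLin.matVarrho (MaxLin.rankOneUpdate M u (a l)) s ≤
      MaxLin.matVarrho (MaxLin.rankOneUpdate M u (a lstar)) s) :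
    -- the two forms of the maximized quantity agree
    (∀ l, MaxLin.matVarrho (MaxLin.rankOneUpdate M u (a l)) s =
      MaxLin.matSpecRadius (Matrix.diagonal s * MaxLin.rankOneUpdate M u (a l))) ∧
    -- the gauge is a convex function on the whole space
    ConvexOn ℝ Set.univ (MaxLin.gaugeNorm (MaxLin.maxLinMap M u nrm)) ∧
    -- the spectral radius is positive and has positive right and left eigenvectors
    0 < MaxLin.matSpecRadius (Matrix.diagonal s * MaxLin.rankOneUpdate M u (a lstar)) ∧
    (∃ ξ, MaxLin.IsRightPerron (Matrix.diagonal s * MaxLin.rankOneUpdate M u (a lstar)) ξ) ∧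
    (∃ η, MaxLin.IsLeftPerron (Matrix.diagonal s * MaxLin.rankOneUpdate M u (a lstar)) η) ∧
    -- any such pair of eigenvectors gives a subgradient
    ∀ ξ η : Fin N → ℝ,
      MaxLin.IsRightPerron (Matrix.diagonal s * MaxLin.rankOneUpdate M u (a lstar)) ξ →
      MaxLin.IsLeftPerron (Matrix.diagonal s * MaxLin.rankOneUpdate M u (a lstar)) η →
      (η ⬝ᵥ ξ)⁻¹ • (Matrix.diagonal η *ᵥ (MaxLin.rankOneUpdate M u (a lstar) *ᵥ ξ)) ∈
        MaxLin.subdifferential (MaxLin.gaugeNorm (MaxLin.maxLinMap M u nrm)) s := by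
  -- A nonzero `a lstar` forces N ≥ 1.
  obtain ⟨i₀, -⟩ := Function.ne_iff.1 (hnrm.ne_zero lstar)
  have : Nonempty (Fin N) := ⟨i₀⟩
  have hA := MaxLin.rankOneUpdate_pos hM hu (hnrm.nonneg lstar)
  have hsA : ∀ i j, 0 < (Matrix.diagonal s * MaxLin.rankOneUpdate M u (a lstar)) i j := by
    intro i j
    rw [Matrix.diagonal_mul]
    exact mul_pos (hs i) (hA i j)
  have hG := MaxLin.isStronglyMonotoneHomogeneous_maxLinMap hM hu hnrm
  obtain ⟨hr, hξ₀⟩ := MaxLin.exists_isRightPerron hsA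
  refine ⟨fun l => MaxLin.matVarrho_eq _ _, MaxLin.convexOn_gaugeNorm hG, hr, hξ₀,
    MaxLin.exists_isLeftPerron hsA, fun ξ η hξ hη y => ?_⟩
  rw [sub_dotProduct, MaxLin.dotProduct_perron_eq hξ hη.1]
  have hs' := MaxLin.gaugeNorm_le hG hs hr (MaxLin.varrho_maxLinMap_le hM hu hnrm
    (fun i => (hs i).le) hr.le fun l => by rw [← MaxLin.matVarrho_eq]; exact hl l)
  have hAT := MaxLin.isStronglyMonotoneHomogeneous_mulVec hA
  have hy := MaxLin.dotProduct_le_gaugeNorm hG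
    (v := (η ⬝ᵥ ξ)⁻¹ • (Matrix.diagonal η *ᵥ (MaxLin.rankOneUpdate M u (a lstar) *ᵥ ξ)))
    (smul_nonneg (inv_nonneg.2 (dotProduct_nonneg_of_nonneg (fun i => (hη.1 i).le)
        fun i => (hξ.1 i).le))
      ((hAT.toIsMonotoneHomogeneous.diagonal fun i => (hη.1 i).le).nonneg
        fun i => (hξ.1 i).le))
    (fun x hx => MaxLin.dotProduct_le_varrho hG (fun z hz =>
      (MaxLin.dotProduct_le_matVarrho hA (hconv lstar) hs hξ hη hz).trans
        (MaxLin.varrho_le_varrho hAT.toIsMonotoneHomogeneous hG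
          (fun p hp => MaxLin.rankOneUpdate_mulVec_le_maxLinMap hu hnrm lstar hp) hz)) hx) y
  linarith
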